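/- Let $d$ and $k\ge 2$ be integers, $d \ge 0$, and put $p_k=\frac{2^k}{k+1}$ and $s_k=\frac{2^k}{2^k-k-1}$, which are Hölder conjugate. All functions are real-valued on $\mathbb{R}^d$ and may take both signs. The Gowers–Host–Kra norms are defined inductively by $$\|f\|_{U(1)}=\Big|\int_{\mathbb{R}^d} f\,dx\Big|,\qquad \|f\|_{U(j+1)}^{2^{j+1}}=\int_{\mathbb{R}^d}\big\|f(\cdot+h)\,f\big\|_{U(j)}^{2^{j}}\,dh\quad(j\ge 1),$$ and the dual function of $f$ is $$D_kf(x)=\int_{(\mathbb{R}^{d})^k}\ \prod_{\alpha\in\{0,1\}^k\setminus\{0\}} f(x+\alpha_1h_1+\cdots+\alpha_kh_k)\,dh_1\cdots dh_k .$$ The $k$-th anti-uniform space $\mathcal{U}^*(k)$ consists of all $g\in L^{s_k}(\mathbb{R}^d)$ with $$\|g\|_{U(k)}^*:=\sup\Big\{\Big|\int_{\mathbb{R}^d} g f\,dx\Big| : f\in L^{p_k}(\mathbb{R}^d),\ \|f\|_{U(k)}\le 1\Big\}<\infty .$$ Then for every $f\in L^{p_k}(\mathbb{R}^d)$ the integral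 defining $D_kf(x)$ converges absolutely for almost every $x$ and $D_kf\in L^{s_k}(\mathbb{R}^d)$; and the closed unit ball $\{g\in\mathcal{U}^*(k):\|g\|_{U(k)}^*\le 1\}$ equals the closed convex hull in $L^{s_k}(\mathbb{R}^d)$ of the set $$\{D_kf : f\in L^{p_k}(\mathbb{R}^d),\ \|f\|_{U(k)}\le 1\}.$$ -/

import Mathlib

open MeasureTheory
open scoped ENNReal

noncomputable section

namespace AntiUniform

/-- The exponent `p_k = 2^k / (k + 1)`. -/
def pExp (k : ℕ) : ℝ≥0∞ := ENNReal.ofReal ((2 : ℝ) ^ k / ((k : ℝ) + 1))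

/-- The exponent `s_k = 2^k / (2^k - k - 1)`, the Hölder conjugate of `p_k` when `k ≥ 2`. -/
def sExp (k : ℕ) : ℝ≥0∞ := ENNReal.ofReal ((2 : ℝ) ^ k / ((2 : ℝ) ^ k - (k : ℝ) - 1))

theorem one_le_sExp {k : ℕ} (hk : 2 ≤ k) : 1 ≤ sExp k := by
  have hlt : k + 1 < 2 ^ k := by
    induction k, hk using Nat.le_induction with
    | base => norm_num
    | succ n hn ih => rw [pow_succ]; omega
  have hR : (k : ℝ) + 1 < (2 : ℝ) ^ k := by exact_mod_cast hlt
  have h0 : (0 : ℝ) ≤ (k : ℝ) := Nat.cast_nonneg k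
  rw [sExp, ENNReal.one_le_ofReal, le_div_iff₀ (by linarith)]
  linarith

instance sExp_fact (k : ℕ) [hk : Fact (2 ≤ k)] : Fact (1 ≤ sExp k) :=
  ⟨one_le_sExp hk.out⟩

/-- The Gowers-Host-Kra norm `‖f‖_{U(k)}` of a real function on `ℝ^d`, defined inductively by
`‖f‖_{U(1)} = |∫ f|` and `‖f‖_{U(k+1)}^{2^(k+1)} = ∫ ‖f(· + h) f‖_{U(k)}^{2^k} dh`.
The index `0` carries no meaning and is never used. -/
def gowersNorm {d : ℕ} : ℕ → (EuclideanSpace ℝ (Fin d) → ℝ) → ℝ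
  | 0, _ => 0
  | 1, f => |∫ x, f x|
  | (k + 2), f =>
      (∫ h : EuclideanSpace ℝ (Fin d),
        gowersNorm (k + 1) (fun x => f (x + h) * f x) ^ (2 ^ (k + 1) : ℕ)) ^
          ((1 : ℝ) / (2 : ℝ) ^ (k + 2))

/-- `α · h = α₁ h₁ + ⋯ + α_k h_k` for a vertex `α` of the cube `{0,1}^k`. -/
def cubeDot {d k : ℕ} (α : Fin k → Bool) (h : Fin k → EuclideanSpace ℝ (Fin d)) :
    EuclideanSpace ℝ (Fin d) :=
  ∑ i, if α i then h i else 0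

/-- The integrand `∏_{α ∈ {0,1}^k, α ≠ 0} f(x + α · h)` of the dual function. -/
def dualIntegrand {d : ℕ} (k : ℕ) (f : EuclideanSpace ℝ (Fin d) → ℝ)
    (x : EuclideanSpace ℝ (Fin d)) (h : Fin k → EuclideanSpace ℝ (Fin d)) : ℝ :=
  ∏ α ∈ Finset.univ.erase (fun _ : Fin k => false), f (x + cubeDot α h)

/-- The Gowers-Host-Kra dual function
`D_k f (x) = ∫_{ℝ^{kd}} ∏_{α ∈ {0,1}^k, α ≠ 0} f(x + α · h) dh`. -/
def dualFunction {d : ℕ} (k : ℕ) (f : EuclideanSpace ℝ (Fin d) → ℝ)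
    (x : EuclideanSpace ℝ (Fin d)) : ℝ :=
  ∫ h : Fin k → EuclideanSpace ℝ (Fin d), dualIntegrand k f x h

/-- The set of values `|⟨g, f⟩|`, for `f ∈ L^{p_k}` with `‖f‖_{U(k)} ≤ 1`. -/
def pairingValues {d : ℕ} (k : ℕ) (g : EuclideanSpace ℝ (Fin d) → ℝ) : Set ℝ :=
  {r | ∃ f : EuclideanSpace ℝ (Fin d) → ℝ,
    MemLp f (pExp k) volume ∧ gowersNorm k f ≤ 1 ∧ r = |∫ x, g x * f x|}

/-- The anti-uniform norm `‖g‖*_{U(k)}`, the supremum of the values `|⟨g, f⟩|`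
(meaningful for `g` in the anti-uniform space, where the supremum is finite). -/
def antiUniformNorm {d : ℕ} (k : ℕ) (g : EuclideanSpace ℝ (Fin d) → ℝ) : ℝ :=
  sSup (pairingValues k g)

/-- The `k`-th anti-uniform space: those `g ∈ L^{s_k}` for which the supremum of `|⟨g, f⟩|`
over `f ∈ L^{p_k}` with `‖f‖_{U(k)} ≤ 1` is finite. -/
def antiUniformSpace (d k : ℕ) :
    Set (Lp ℝ (sExp k) (volume : Measure (EuclideanSpace ℝ (Fin d)))) :=
  {g | BddAbove (pairingValues k g)}

/-- The closed unit ball of the `k`-th anti-uniform space. -/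
def antiUniformUnitBall (d k : ℕ) :
    Set (Lp ℝ (sExp k) (volume : Measure (EuclideanSpace ℝ (Fin d)))) :=
  {g | g ∈ antiUniformSpace d k ∧ antiUniformNorm k g ≤ 1}

/-- The set `{D_k f : f ∈ L^{p_k}, ‖f‖_{U(k)} ≤ 1}`, as classes in `L^{s_k}`. -/
def dualSet (d k : ℕ) :
    Set (Lp ℝ (sExp k) (volume : Measure (EuclideanSpace ℝ (Fin d)))) :=
  {g | ∃ f : EuclideanSpace ℝ (Fin d) → ℝ,
    MemLp f (pExp k) volume ∧ gowersNorm k f ≤ 1 ∧ g =ᵐ[volume] dualFunction k f}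

end AntiUniform

end

/-!
Over `{0, 1}^k`, the Gowers form `∬ ∏_α F_α(x + α · h) dx dh` is bounded by `∏_α ‖F_α‖_{p_k}`:
splitting off one difference `h₁` pairs opposite faces into products `F_α F_β(· + h₁)`, whose
`L^{p_k}` norms are averaged over `h₁` by Young's convolution inequality. With `g` at the vertex `0`
and `f` elsewhere, the form is the pairing of `g` with `D_k f`, so by the converse of Hölder's
inequality `D_k f` lies in `L^{s_k}`; the Gowers–Cauchy–Schwarz inequality bounds the pairing by
`‖g‖_{U(k)} ‖f‖_{U(k)}^{2^k - 1}`, which puts `D_k f` in the unit ball when `‖f‖_{U(k)} ≤ 1`.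

Conversely, a `g` outside the closed convex hull is separated from it by some `f ∈ L^{p_k}`, so that
`⟨f, D_k v⟩ < u < ⟨f, g⟩` for every admissible `v`. As `⟨f, D_k f⟩ = ‖f‖_{U(k)}^{2^k}`, testing
with `v = f / ‖f‖_{U(k)}` gives `‖f‖_{U(k)} < u < ⟨f, g⟩`, and `g` is not in the unit ball.
-/

noncomputable section

open Filter Topology
open scoped NNReal symmDiff

namespace AntiUniform

section Young

variable {G : Type*} [MeasurableSpace G] {μ : Measure G}

theorem lintegral_mul_le_rpow_mul_rpow_mul_rpow {p q r : ℝ} (hp : 1 ≤ p) (hq : 1 ≤ q)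
    (hr : 0 < r) (hpqr : p⁻¹ + q⁻¹ = 1 + r⁻¹) {A B : G → ℝ≥0∞} (hA : AEMeasurable A μ)
    (hB : AEMeasurable B μ) :
    ∫⁻ x, A x * B x ∂μ ≤ (∫⁻ x, A x ^ p * B x ^ q ∂μ) ^ r⁻¹ *
      ((∫⁻ x, A x ^ p ∂μ) ^ (p⁻¹ - r⁻¹) * (∫⁻ x, B x ^ q ∂μ) ^ (q⁻¹ - r⁻¹)) := by
  have hrp : 0 ≤ p⁻¹ - r⁻¹ := by linarith [inv_le_one_of_one_le₀ hq]
  have hrq : 0 ≤ q⁻¹ - r⁻¹ := by linarith [inv_le_one_of_one_le₀ hp]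
  have hr' : 0 ≤ r⁻¹ := inv_nonneg.2 hr.le
  have hsplit (a : ℝ≥0∞) {s : ℝ} (hs : 1 ≤ s) (hrs : 0 ≤ s⁻¹ - r⁻¹) :
      a = (a ^ s) ^ r⁻¹ * (a ^ s) ^ (s⁻¹ - r⁻¹) := by
    rw [← ENNReal.rpow_add_of_nonneg _ _ hr' hrs, add_sub_cancel,
      ENNReal.rpow_rpow_inv (by linarith)]
  have hholder := ENNReal.lintegral_prod_norm_pow_le (μ := μ) Finset.univ
    (f := ![fun x => A x ^ p * B x ^ q, fun x => A x ^ p, fun x => B x ^ q])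
    (p := ![r⁻¹, p⁻¹ - r⁻¹, q⁻¹ - r⁻¹])
    (by simpa [Fin.forall_fin_succ] using
      ⟨(hA.pow_const p).mul (hB.pow_const q), hA.pow_const p, hB.pow_const q⟩)
    (by rw [Fin.sum_univ_three]; simp only [Matrix.cons_val]; linarith)
    (by simp [Fin.forall_fin_succ, *])
  simp only [Fin.prod_univ_three, Matrix.cons_val] at hholder
  calc ∫⁻ x, A x * B x ∂μ
      = ∫⁻ x, (A x ^ p * B x ^ q) ^ r⁻¹ * (A x ^ p) ^ (p⁻¹ - r⁻¹) *
          (B x ^ q) ^ (q⁻¹ - r⁻¹) ∂μ := by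
        congr with x
        rw [ENNReal.mul_rpow_of_nonneg _ _ hr']
        conv_lhs => rw [hsplit (A x) hp hrp, hsplit (B x) hq hrq]
        ring
    _ ≤ _ := hholder.trans_eq (mul_assoc _ _ _)

variable [AddGroup G] [MeasurableAdd₂ G] [SFinite μ] [μ.IsAddLeftInvariant]

theorem aemeasurable_mul_comp_add {A B : G → ℝ≥0∞} (hA : AEMeasurable A μ)
    (hB : AEMeasurable B μ) :
    AEMeasurable (fun z : G × G => A z.2 * B (z.2 + z.1)) (μ.prod μ) :=
  (hA.comp_quasiMeasurePreserving Measure.quasiMeasurePreserving_snd).mul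
    (hB.comp_quasiMeasurePreserving (quasiMeasurePreserving_add_swap μ μ))

theorem lintegral_lintegral_mul_comp_add {A B : G → ℝ≥0∞} (hA : AEMeasurable A μ)
    (hB : AEMeasurable B μ) :
    ∫⁻ h, ∫⁻ x, A x * B (x + h) ∂μ ∂μ = (∫⁻ x, A x ∂μ) * ∫⁻ x, B x ∂μ := by
  rw [lintegral_lintegral_swap (aemeasurable_mul_comp_add hA hB), ← lintegral_mul_const'' _ hA]
  refine lintegral_congr fun x => ?_
  have hBx := hB.comp_quasiMeasurePreserving
    (measurePreserving_add_left μ x).quasiMeasurePreserving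
  exact (lintegral_const_mul'' (A x) hBx).trans (by rw [← lintegral_add_left_eq_self B x]; rfl)

theorem lintegral_lintegral_mul_comp_add_rpow_le [μ.IsAddRightInvariant] {p q r : ℝ}
    (hp : 1 ≤ p) (hq : 1 ≤ q) (hr : 0 < r) (hpqr : p⁻¹ + q⁻¹ = 1 + r⁻¹) {A B : G → ℝ≥0∞}
    (hA : AEMeasurable A μ) (hB : AEMeasurable B μ) :
    ∫⁻ h, (∫⁻ x, A x * B (x + h) ∂μ) ^ r ∂μ ≤
      (∫⁻ x, A x ^ p ∂μ) ^ (r / p) * (∫⁻ x, B x ^ q ∂μ) ^ (r / q) := by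
  set a := ∫⁻ x, A x ^ p ∂μ with ha
  set b := ∫⁻ x, B x ^ q ∂μ with hb
  have hcomb (c : ℝ≥0∞) {s : ℝ} (hrs : 0 ≤ s⁻¹ - r⁻¹) :
      c * (c ^ (s⁻¹ - r⁻¹)) ^ r = c ^ (r / s) := by
    rw [← ENNReal.rpow_mul]
    conv_lhs => enter [1]; rw [← ENNReal.rpow_one c]
    rw [← ENNReal.rpow_add_of_nonneg _ _ zero_le_one (mul_nonneg hrs hr.le)]
    congr 1
    field_simp
    ring
  have hpointwise (h : G) : (∫⁻ x, A x * B (x + h) ∂μ) ^ r ≤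
      (∫⁻ x, A x ^ p * B (x + h) ^ q ∂μ) *
        ((a ^ (p⁻¹ - r⁻¹)) ^ r * (b ^ (q⁻¹ - r⁻¹)) ^ r) := by
    have hholder := lintegral_mul_le_rpow_mul_rpow_mul_rpow hp hq hr hpqr hA
      (hB.comp_quasiMeasurePreserving (measurePreserving_add_right μ h).quasiMeasurePreserving)
    simp only [Function.comp_apply] at hholder
    rw [lintegral_add_right_eq_self (fun x => B x ^ q) h, ← ha, ← hb] at hholder
    refine (ENNReal.rpow_le_rpow hholder hr.le).trans_eq ?_
    rw [ENNReal.mul_rpow_of_nonneg _ _ hr.le, ENNReal.mul_rpow_of_nonneg _ _ hr.le,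
      ENNReal.rpow_inv_rpow hr.ne']
  calc ∫⁻ h, (∫⁻ x, A x * B (x + h) ∂μ) ^ r ∂μ
      ≤ ∫⁻ h, (∫⁻ x, A x ^ p * B (x + h) ^ q ∂μ) *
          ((a ^ (p⁻¹ - r⁻¹)) ^ r * (b ^ (q⁻¹ - r⁻¹)) ^ r) ∂μ := lintegral_mono hpointwise
    _ = a * b * ((a ^ (p⁻¹ - r⁻¹)) ^ r * (b ^ (q⁻¹ - r⁻¹)) ^ r) := by
        rw [lintegral_mul_const'' _
            (aemeasurable_mul_comp_add (hA.pow_const p) (hB.pow_const q)).lintegral_prod_right,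
          lintegral_lintegral_mul_comp_add (hA.pow_const p) (hB.pow_const q)]
    _ = a ^ (r / p) * b ^ (r / q) := by
        rw [← hcomb a (by linarith [inv_le_one_of_one_le₀ hq]),
          ← hcomb b (by linarith [inv_le_one_of_one_le₀ hp])]
        ring

end Young

section ConverseHolder

variable {α : Type*} [MeasurableSpace α] {μ : Measure α} {p q : ℝ≥0∞}

theorem le_rpow_of_le_mul_rpow_inv {p q : ℝ} (hpq : p.HolderConjugate q) {a C : ℝ≥0∞}
    (ha : a ≠ ∞) (h : a ≤ C * a ^ p⁻¹) : a ≤ C ^ q := by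
  rcases eq_or_ne a 0 with rfl | ha₀
  · exact zero_le
  rw [← ENNReal.rpow_inv_le_iff hpq.symm.pos, ← hpq.one_sub_inv, ENNReal.rpow_sub _ _ ha₀ ha,
    ENNReal.rpow_one]
  exact ENNReal.div_le_of_le_mul h

theorem exists_simpleFunc_lt_lintegral [SigmaFinite μ] {S : α → ℝ≥0∞} {L : ℝ≥0∞}
    (hL : L < ∫⁻ x, S x ∂μ) :
    ∃ φ : SimpleFunc α ℝ≥0, (∀ x, (φ x : ℝ≥0∞) ≤ S x) ∧ ∫⁻ x, φ x ∂μ < ∞ ∧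
      L < ∫⁻ x, φ x ∂μ := by
  simp_rw [lintegral_eq_nnreal, lt_iSup_iff] at hL
  obtain ⟨ψ, hψS, hLψ⟩ := hL
  rw [← SimpleFunc.lintegral_eq_lintegral] at hLψ
  obtain ⟨φ, hφψ, hφ, hLφ⟩ := exists_lt_lintegral_simpleFunc_of_lt_lintegral hLψ
  exact ⟨φ, fun x => (ENNReal.coe_le_coe.2 (hφψ x)).trans (hψS x), hφ, hLφ⟩

theorem eLpNorm_le_of_forall_lintegral_mul_le [SigmaFinite μ] [p.HolderConjugate q] (hp : p ≠ ∞)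
    (hq : q ≠ ∞) {S : α → ℝ≥0∞} {C : ℝ≥0∞}
    (h : ∀ u : SimpleFunc α ℝ≥0, eLpNorm (fun x => (u x : ℝ)) p μ < ∞ →
      ∫⁻ x, u x * S x ∂μ ≤ C * eLpNorm (fun x => (u x : ℝ)) p μ) :
    eLpNorm S q μ ≤ C := by
  have hpq' := ENNReal.HolderConjugate.toReal_of_ne_top hp hq
  rw [eLpNorm_eq_lintegral_rpow_enorm_toReal (ENNReal.HolderConjugate.ne_zero q p) hq, one_div,
    ENNReal.rpow_inv_le_iff hpq'.symm.pos]
  refine le_of_forall_lt fun L hL => ?_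
  obtain ⟨φ, hφS, hφ, hLφ⟩ := exists_simpleFunc_lt_lintegral hL
  have hp₀ := hpq'.pos
  set u : SimpleFunc α ℝ≥0 := φ.map (fun a => a ^ p.toReal⁻¹) with hu
  have hueq : eLpNorm (fun x => (u x : ℝ)) p μ = (∫⁻ x, φ x ∂μ) ^ p.toReal⁻¹ := by
    rw [eLpNorm_eq_lintegral_rpow_enorm_toReal (ENNReal.HolderConjugate.ne_zero p q) hp, one_div]
    congr 2 with x
    rw [hu, SimpleFunc.map_apply, NNReal.enorm_eq,
      ← ENNReal.coe_rpow_of_nonneg _ hp₀.le, NNReal.rpow_inv_rpow hp₀.ne']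
  have hφu (x : α) : (φ x : ℝ≥0∞) ≤ u x * S x := by
    calc (φ x : ℝ≥0∞) = (φ x : ℝ≥0∞) ^ p.toReal⁻¹ * (φ x : ℝ≥0∞) ^ q.toReal⁻¹ := by
          rw [← ENNReal.rpow_add_of_nonneg _ _ (inv_nonneg.2 hp₀.le)
            (inv_nonneg.2 hpq'.symm.pos.le), hpq'.inv_add_inv_eq_one, ENNReal.rpow_one]
      _ ≤ u x * S x := by
          rw [hu, SimpleFunc.map_apply, ENNReal.coe_rpow_of_nonneg _ (inv_nonneg.2 hp₀.le)]
          gcongr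
          exact (ENNReal.rpow_inv_le_iff hpq'.symm.pos).2 (hφS x)
  refine hLφ.trans_le (le_rpow_of_le_mul_rpow_inv hpq' hφ.ne ?_)
  rw [← hueq]
  refine (lintegral_mono hφu).trans (h u ?_)
  rw [hueq]
  exact ENNReal.rpow_lt_top_of_nonneg (inv_nonneg.2 ENNReal.toReal_nonneg) hφ.ne

end ConverseHolder

section Density

variable {α : Type*} [MeasurableSpace α] {μ : Measure α} {p : ℝ≥0∞} {g : α → ℝ≥0}

theorem eLpNorm_rpow_inv_smul (hg : Measurable g) (hp₀ : p ≠ 0) (hp : p ≠ ∞) (u : α → ℝ) :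
    eLpNorm (fun x => g x ^ p.toReal⁻¹ • u x) p μ = eLpNorm u p (μ.withDensity fun x => g x) := by
  have hp' := ENNReal.toReal_pos hp₀ hp
  rw [eLpNorm_eq_lintegral_rpow_enorm_toReal hp₀ hp, eLpNorm_eq_lintegral_rpow_enorm_toReal hp₀ hp,
    lintegral_withDensity_eq_lintegral_mul_non_measurable μ hg.coe_nnreal_ennreal
      (.of_forall fun _ => ENNReal.coe_lt_top)]
  congr 2 with x
  rw [NNReal.smul_def, enorm_smul, NNReal.enorm_eq, ENNReal.mul_rpow_of_nonneg _ _ hp'.le,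
    ← ENNReal.coe_rpow_of_nonneg _ hp'.le, NNReal.rpow_inv_rpow hp'.ne', Pi.mul_apply]

theorem absolutelyContinuous_withDensity (hg : Measurable g) (hg₀ : ∀ x, g x ≠ 0) :
    μ ≪ μ.withDensity fun x => g x :=
  withDensity_absolutelyContinuous' hg.coe_nnreal_ennreal.aemeasurable
    (.of_forall fun x => ENNReal.coe_ne_zero.2 (hg₀ x))

theorem memLp_rpow_inv_smul (hg : Measurable g) (hg₀ : ∀ x, g x ≠ 0) (hp₀ : p ≠ 0) (hp : p ≠ ∞)
    {u : α → ℝ} (hu : MemLp u p (μ.withDensity fun x => g x)) :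
    MemLp (fun x => g x ^ p.toReal⁻¹ • u x) p μ := by
  refine ⟨(hg.pow_const _).aestronglyMeasurable.smul
    (hu.1.mono_ac (absolutelyContinuous_withDensity hg hg₀)), ?_⟩
  rw [eLpNorm_rpow_inv_smul hg hp₀ hp]
  exact hu.2

variable [hp₁ : Fact (1 ≤ p)]

/-- Multiplication by `g ^ (1 / p)`, as an isometry `L^p(g μ) → L^p(μ)`. -/
def rpowInvSMulLp (hg : Measurable g) (hg₀ : ∀ x, g x ≠ 0) (hp : p ≠ ∞) :
    Lp ℝ p (μ.withDensity fun x => g x) →ₗᵢ[ℝ] Lp ℝ p μ where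
  toFun u := (memLp_rpow_inv_smul hg hg₀ (one_pos.trans_le hp₁.out).ne' hp (Lp.memLp u)).toLp _
  map_add' u v := by
    rw [← MemLp.toLp_add]
    refine MemLp.toLp_congr _ _ ?_
    filter_upwards [(absolutelyContinuous_withDensity hg hg₀).ae_eq (Lp.coeFn_add u v)] with x hx
    simp only [hx, Pi.add_apply, smul_add]
  map_smul' c u := by
    rw [← MemLp.toLp_const_smul]
    refine MemLp.toLp_congr _ _ ?_
    filter_upwards [(absolutelyContinuous_withDensity hg hg₀).ae_eq (Lp.coeFn_smul c u)] with x hx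
    rw [hx, RingHom.id_apply, Pi.smul_apply, Pi.smul_apply, smul_comm]
  norm_map' u := by
    have hp₀ : p ≠ 0 := (one_pos.trans_le hp₁.out).ne'
    refine (Lp.norm_toLp _ (memLp_rpow_inv_smul hg hg₀ hp₀ hp (Lp.memLp u))).trans ?_
    rw [eLpNorm_rpow_inv_smul hg hp₀ hp, ← Lp.norm_def]

theorem rpowInvSMulLp_apply (hg : Measurable g) (hg₀ : ∀ x, g x ≠ 0) (hp : p ≠ ∞)
    (u : Lp ℝ p (μ.withDensity fun x => g x)) :
    rpowInvSMulLp hg hg₀ hp u =ᵐ[μ] fun x => g x ^ p.toReal⁻¹ • u x :=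
  (memLp_rpow_inv_smul hg hg₀ (one_pos.trans_le hp₁.out).ne' hp (Lp.memLp u)).coeFn_toLp

theorem rpowInvSMulLp_toLp (hg : Measurable g) (hg₀ : ∀ x, g x ≠ 0) (hp : p ≠ ∞)
    (u : Lp ℝ p μ)
    (hu : MemLp (fun x => (g x ^ p.toReal⁻¹)⁻¹ • u x) p (μ.withDensity fun x => g x)) :
    rpowInvSMulLp hg hg₀ hp (hu.toLp _) = u := by
  refine Lp.ext ((rpowInvSMulLp_apply ..).trans ?_)
  filter_upwards [(absolutelyContinuous_withDensity hg hg₀).ae_eq hu.coeFn_toLp] with x hx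
  rw [hx, smul_inv_smul₀ (NNReal.rpow_pos (pos_iff_ne_zero.2 (hg₀ x))).ne']

end Density

section Duality

variable {α : Type*} [MeasurableSpace α] {μ : Measure α} {p q : ℝ≥0∞}

theorem tendsto_measure_biUnion_symmDiff_iUnion {ι : Type*} [Countable ι] {A : ι → Set α}
    (hA : ∀ i, MeasurableSet (A i)) (hfin : μ (⋃ i, A i) ≠ ∞) :
    Tendsto (fun s : Finset ι => μ ((⋃ i ∈ s, A i) ∆ ⋃ i, A i)) atTop (𝓝 0) := by
  have hsub (s : Finset ι) : ⋃ i ∈ s, A i ⊆ ⋃ i, A i := Set.iUnion₂_subset_iUnion _ _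
  have hunion : ⋃ s : Finset ι, ⋃ i ∈ s, A i = ⋃ i, A i := (Set.iUnion_eq_iUnion_finset A).symm
  have hmono : Monotone fun s : Finset ι => ⋃ i ∈ s, A i := fun s t hst =>
    Set.biUnion_subset_biUnion_left hst
  have hlim := ENNReal.Tendsto.sub (tendsto_const_nhds (x := μ (⋃ i, A i)))
    (tendsto_measure_iUnion_atTop (μ := μ) hmono) (.inl hfin)
  rw [hunion, tsub_self] at hlim
  refine hlim.congr fun s => ?_
  rw [symmDiff_of_le (hsub s), measure_sdiff (hsub s)
    (Finset.measurableSet_biUnion s fun i _ => hA i).nullMeasurableSet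
    (measure_ne_top_of_subset (hsub s) hfin), Function.comp_apply]

theorem integrable_mul_simpleFunc {f : α → ℝ} (hf : Integrable f μ) (u : SimpleFunc α ℝ) :
    Integrable (fun x => f x * u x) μ :=
  hf.mul_bdd u.aestronglyMeasurable (.of_forall u.exists_forall_norm_le.choose_spec)

variable [hp₁ : Fact (1 ≤ p)]

theorem hasSum_indicatorConstLp_iUnion [IsFiniteMeasure μ] (hp : p ≠ ∞) {ι : Type*} [Countable ι]
    {A : ι → Set α} (hA : ∀ i, MeasurableSet (A i)) (hdisj : Pairwise (Function.onFun Disjoint A))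
    (c : ℝ) :
    HasSum (fun i => indicatorConstLp p (hA i) (measure_ne_top μ _) c)
      (indicatorConstLp p (MeasurableSet.iUnion hA) (measure_ne_top μ _) c) := by
  classical
  have hbUnion (s : Finset ι) : MeasurableSet (⋃ i ∈ s, A i) :=
    s.measurableSet_biUnion fun i _ => hA i
  have hsum (s : Finset ι) : ∑ i ∈ s, indicatorConstLp p (hA i) (measure_ne_top μ _) c =
      indicatorConstLp p (hbUnion s) (measure_ne_top μ _) c := by
    induction s using Finset.induction with
    | empty => simp
    | insert i s hi ih =>
      have hAs : Disjoint (A i) (⋃ j ∈ s, A j) :=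
        Set.disjoint_iUnion₂_right.2 fun j hj => hdisj (ne_of_mem_of_not_mem hj hi).symm
      rw [Finset.sum_insert hi, ih, ← indicatorConstLp_disjoint_union _ _ _ _ hAs]
      simp only [Finset.set_biUnion_insert]
  simp only [HasSum, hsum]
  exact tendsto_indicatorConstLp_set hp
    (tendsto_measure_biUnion_symmDiff_iUnion hA (measure_ne_top μ _))

open Classical in
/-- The signed measure `A ↦ Λ(1_A)` of a continuous functional `Λ` on `L^p` of a finite measure. -/
def indicatorMeasure [IsFiniteMeasure μ] (hp : p ≠ ∞) (Λ : StrongDual ℝ (Lp ℝ p μ)) :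
    SignedMeasure α where
  measureOf' A := if hA : MeasurableSet A then
    Λ (indicatorConstLp p hA (measure_ne_top μ A) 1) else 0
  empty' := by simp
  not_measurable' _ hA := dif_neg hA
  m_iUnion' A hA hdisj := by
    simpa only [hA, MeasurableSet.iUnion hA, dif_pos] using
      (hasSum_indicatorConstLp_iUnion hp hA hdisj 1).mapL Λ

theorem indicatorMeasure_apply [IsFiniteMeasure μ] (hp : p ≠ ∞) (Λ : StrongDual ℝ (Lp ℝ p μ))
    {A : Set α} (hA : MeasurableSet A) :
    indicatorMeasure hp Λ A = Λ (indicatorConstLp p hA (measure_ne_top μ A) 1) :=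
  dif_pos hA

theorem exists_integrable_forall_indicatorConstLp_eq_setIntegral [IsFiniteMeasure μ] (hp : p ≠ ∞)
    (Λ : StrongDual ℝ (Lp ℝ p μ)) :
    ∃ f : α → ℝ, Measurable f ∧ Integrable f μ ∧ ∀ (A : Set α) (hA : MeasurableSet A),
      Λ (indicatorConstLp p hA (measure_ne_top μ A) 1) = ∫ x in A, f x ∂μ := by
  have hac : indicatorMeasure hp Λ ≪ᵥ μ.toENNRealVectorMeasure := by
    refine VectorMeasure.AbsolutelyContinuous.mk fun A hA hμA => ?_
    rw [Measure.toENNRealVectorMeasure_apply_measurable hA] at hμA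
    have hzero : indicatorConstLp p hA (measure_ne_top μ A) (1 : ℝ) = 0 := by
      rw [← norm_eq_zero, norm_indicatorConstLp (one_pos.trans_le hp₁.out).ne' hp,
        measureReal_def, hμA]
      simp [hp, (one_pos.trans_le hp₁.out).ne', ENNReal.toReal_eq_zero_iff]
    rw [indicatorMeasure_apply hp Λ hA, hzero, map_zero]
  refine ⟨(indicatorMeasure hp Λ).rnDeriv μ, SignedMeasure.measurable_rnDeriv _ _,
    SignedMeasure.integrable_rnDeriv _ _, fun A hA => ?_⟩
  rw [← withDensityᵥ_apply (SignedMeasure.integrable_rnDeriv _ _) hA,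
    SignedMeasure.withDensityᵥ_rnDeriv_eq _ _ hac, indicatorMeasure_apply hp Λ hA]

theorem apply_toLp_eq_integral_mul_of_simpleFunc [IsFiniteMeasure μ] {Λ : StrongDual ℝ (Lp ℝ p μ)}
    {f : α → ℝ} (hf : Integrable f μ) (hΛ : ∀ (A : Set α) (hA : MeasurableSet A),
      Λ (indicatorConstLp p hA (measure_ne_top μ A) 1) = ∫ x in A, f x ∂μ)
    (u : SimpleFunc α ℝ) :
    Λ ((u.memLp_of_isFiniteMeasure p μ).toLp u) = ∫ x, f x * u x ∂μ := by
  induction u using SimpleFunc.induction with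
  | @const c A hA =>
    have hsmul : (SimpleFunc.memLp_of_isFiniteMeasure _ p μ).toLp (SimpleFunc.piecewise A hA
        (SimpleFunc.const α c) (SimpleFunc.const α 0)) =
        c • indicatorConstLp p hA (measure_ne_top μ A) (1 : ℝ) := by
      rw [indicatorConstLp, ← MemLp.toLp_const_smul]
      refine MemLp.toLp_congr _ _ (.of_forall fun x => ?_)
      by_cases hx : x ∈ A <;> simp [hx]
    rw [hsmul, map_smul, hΛ A hA, ← integral_indicator hA, smul_eq_mul, ← integral_const_mul]
    refine integral_congr_ae (.of_forall fun x => ?_)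
    by_cases hx : x ∈ A <;> simp [hx, mul_comm]
  | @add u v _ hu hv =>
    calc Λ ((SimpleFunc.memLp_of_isFiniteMeasure (u + v) p μ).toLp _)
        = Λ ((u.memLp_of_isFiniteMeasure p μ).toLp u + (v.memLp_of_isFiniteMeasure p μ).toLp v) :=
          rfl
      _ = ∫ x, f x * u x ∂μ + ∫ x, f x * v x ∂μ := by rw [map_add, hu, hv]
      _ = ∫ x, f x * (u + v) x ∂μ := by
          rw [← integral_add (integrable_mul_simpleFunc hf u) (integrable_mul_simpleFunc hf v)]
          simp only [SimpleFunc.coe_add, Pi.add_apply, mul_add]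

theorem memLp_of_forall_simpleFunc_apply_eq_integral_mul [IsFiniteMeasure μ]
    [p.HolderConjugate q] (hp : p ≠ ∞) (hq : q ≠ ∞) {Λ : StrongDual ℝ (Lp ℝ p μ)} {f : α → ℝ}
    (hfm : Measurable f) (hf : Integrable f μ)
    (hΛ : ∀ u : SimpleFunc α ℝ,
      Λ ((u.memLp_of_isFiniteMeasure p μ).toLp u) = ∫ x, f x * u x ∂μ) :
    MemLp f q μ := by
  have hnonneg : MeasurableSet {x | 0 ≤ f x} := measurableSet_le measurable_const hfm
  suffices h : eLpNorm (fun x => ‖f x‖ₑ) q μ ≤ ‖Λ‖ₑ from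
    ⟨hfm.aestronglyMeasurable, ((eLpNorm_enorm f).symm.trans_le h).trans_lt enorm_lt_top⟩
  refine eLpNorm_le_of_forall_lintegral_mul_le hp hq fun u _ => ?_
  set v : SimpleFunc α ℝ := u.map (↑)
  set w : SimpleFunc α ℝ := SimpleFunc.piecewise {x | 0 ≤ f x} hnonneg v (-v)
  have hfw (x : α) : f x * w x = u x * ‖f x‖ := by
    by_cases hx : 0 ≤ f x
    · simp [w, v, hx, mul_comm, abs_of_nonneg hx]
    · simp [w, v, hx, mul_comm, abs_of_neg (not_le.1 hx)]
  have hwu (x : α) : ‖w x‖ₑ = ‖(u x : ℝ)‖ₑ := by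
    by_cases hx : 0 ≤ f x <;> simp [w, v, hx]
  have hnn : 0 ≤ᵐ[μ] fun x => f x * w x :=
    .of_forall fun x => (mul_nonneg (u x).coe_nonneg (norm_nonneg _)).trans_eq (hfw x).symm
  calc ∫⁻ x, u x * ‖f x‖ₑ ∂μ = ∫⁻ x, ENNReal.ofReal (f x * w x) ∂μ := by
        congr with x
        rw [hfw, ENNReal.ofReal_mul (u x).coe_nonneg, ofReal_norm, ENNReal.ofReal_coe_nnreal]
    _ = ENNReal.ofReal (∫ x, f x * w x ∂μ) :=
        (ofReal_integral_eq_lintegral_ofReal (integrable_mul_simpleFunc hf w) hnn).symm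
    _ = ENNReal.ofReal (Λ ((w.memLp_of_isFiniteMeasure p μ).toLp w)) := by rw [hΛ]
    _ ≤ ‖Λ‖ₑ * ‖(w.memLp_of_isFiniteMeasure p μ).toLp w‖ₑ :=
        (Real.ofReal_le_enorm _).trans (Λ.le_opENorm _)
    _ = ‖Λ‖ₑ * eLpNorm (fun x => (u x : ℝ)) p μ := by
        rw [Lp.enorm_toLp, eLpNorm_congr_enorm_ae (.of_forall hwu)]

theorem lpPairing_mul_apply [Fact (1 ≤ q)] [q.HolderConjugate p] {f : α → ℝ} (hf : MemLp f q μ)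
    (u : Lp ℝ p μ) :
    ContinuousLinearMap.lpPairing μ q p (ContinuousLinearMap.mul ℝ ℝ) (hf.toLp f) u =
      ∫ x, f x * u x ∂μ := by
  rw [ContinuousLinearMap.lpPairing_eq_integral]
  refine integral_congr_ae ?_
  filter_upwards [hf.coeFn_toLp] with x hx
  rw [hx, ContinuousLinearMap.mul_apply']

theorem exists_memLp_forall_eq_integral_mul_of_isFiniteMeasure [IsFiniteMeasure μ]
    [p.HolderConjugate q] (hp : p ≠ ∞) (hq : q ≠ ∞) (Λ : StrongDual ℝ (Lp ℝ p μ)) :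
    ∃ f : α → ℝ, MemLp f q μ ∧ ∀ u : Lp ℝ p μ, Λ u = ∫ x, f x * u x ∂μ := by
  obtain ⟨f, hfm, hf, hΛA⟩ := exists_integrable_forall_indicatorConstLp_eq_setIntegral hp Λ
  have hΛ := apply_toLp_eq_integral_mul_of_simpleFunc hf hΛA
  have hfq : MemLp f q μ := memLp_of_forall_simpleFunc_apply_eq_integral_mul hp hq hfm hf hΛ
  have : Fact (1 ≤ q) := ⟨ENNReal.HolderConjugate.one_le q p⟩
  refine ⟨f, hfq, fun u => ?_⟩
  rw [← lpPairing_mul_apply hfq]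
  refine congrFun ((Lp.simpleFunc.denseRange (E := ℝ) (μ := μ) hp).equalizer Λ.continuous
    (ContinuousLinearMap.continuous _) (funext fun v => ?_)) u
  have hv : (v : Lp ℝ p μ) = ((Lp.simpleFunc.toSimpleFunc v).memLp_of_isFiniteMeasure p μ).toLp _ :=
    congrArg Subtype.val (Lp.simpleFunc.toLp_toSimpleFunc v).symm
  rw [Function.comp_apply, Function.comp_apply, lpPairing_mul_apply hfq, hv, hΛ]
  refine integral_congr_ae ?_
  filter_upwards [MemLp.coeFn_toLp
    ((Lp.simpleFunc.toSimpleFunc v).memLp_of_isFiniteMeasure p μ)] with x hx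
  rw [hx]

theorem exists_memLp_forall_eq_integral_mul [SigmaFinite μ] [p.HolderConjugate q] (hp : p ≠ ∞)
    (hq : q ≠ ∞) (Λ : StrongDual ℝ (Lp ℝ p μ)) :
    ∃ f : α → ℝ, MemLp f q μ ∧ ∀ u : Lp ℝ p μ, Λ u = ∫ x, f x * u x ∂μ := by
  obtain ⟨g, hg_pos, hg, hgμ⟩ := exists_pos_lintegral_lt_of_sigmaFinite μ one_ne_zero
  have hg₀ (x : α) : g x ≠ 0 := (hg_pos x).ne'
  have hp₀ : p ≠ 0 := (one_pos.trans_le hp₁.out).ne'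
  have hpq := ENNReal.HolderConjugate.toReal_of_ne_top (p := p) (q := q) hp hq
  have := isFiniteMeasure_withDensity (hgμ.trans_le le_top).ne
  obtain ⟨f, hf, hΛ⟩ := exists_memLp_forall_eq_integral_mul_of_isFiniteMeasure (q := q) hp hq
    (Λ.comp (rpowInvSMulLp hg hg₀ hp).toContinuousLinearMap)
  refine ⟨_, memLp_rpow_inv_smul hg hg₀ (ENNReal.HolderConjugate.ne_zero q p) hq hf, fun u => ?_⟩
  have hcancel (x : α) : g x ^ p.toReal⁻¹ • (g x ^ p.toReal⁻¹)⁻¹ • u x = u x :=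
    smul_inv_smul₀ (NNReal.rpow_pos (hg_pos x)).ne' _
  have hv : MemLp (fun x => (g x ^ p.toReal⁻¹)⁻¹ • u x) p (μ.withDensity fun x => g x) := by
    refine ⟨(hg.pow_const _).inv.aestronglyMeasurable.smul
      ((Lp.aestronglyMeasurable u).mono_ac (withDensity_absolutelyContinuous _ _)), ?_⟩
    rw [← eLpNorm_rpow_inv_smul hg hp₀ hp]
    simp only [hcancel]
    exact Lp.eLpNorm_lt_top u
  calc Λ u = Λ (rpowInvSMulLp hg hg₀ hp (hv.toLp _)) := by rw [rpowInvSMulLp_toLp]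
    _ = ∫ x, f x * hv.toLp _ x ∂μ.withDensity fun x => g x := hΛ _
    _ = ∫ x, f x * ((g x ^ p.toReal⁻¹)⁻¹ • u x) ∂μ.withDensity fun x => g x :=
        integral_congr_ae (hv.coeFn_toLp.mono fun x hx => congrArg (f x * ·) hx)
    _ = ∫ x, g x • (f x * ((g x ^ p.toReal⁻¹)⁻¹ • u x)) ∂μ :=
        integral_withDensity_eq_integral_smul hg _
    _ = ∫ x, g x ^ q.toReal⁻¹ • f x * u x ∂μ := by
        congr with x
        rw [← hcancel x, smul_mul_smul_comm, ← NNReal.rpow_add (hg₀ x),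
          hpq.symm.inv_add_inv_eq_one, NNReal.rpow_one, hcancel]

end Duality

local notation "ℝ^" d:max => EuclideanSpace ℝ (Fin d)

theorem toReal_pExp (k : ℕ) : (pExp k).toReal = 2 ^ k / (k + 1) :=
  ENNReal.toReal_ofReal (by positivity)

theorem pExp_ne_zero (k : ℕ) : pExp k ≠ 0 :=
  (ENNReal.ofReal_pos.2 (by positivity)).ne'

theorem pExp_ne_top (k : ℕ) : pExp k ≠ ∞ :=
  ENNReal.ofReal_ne_top

theorem eLpNorm_pExp_pow {α : Type*} [MeasurableSpace α] {μ : Measure α} (k : ℕ) (f : α → ℝ) :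
    eLpNorm f (pExp k) μ ^ 2 ^ k = (∫⁻ x, ‖f x‖ₑ ^ (pExp k).toReal ∂μ) ^ (k + 1 : ℝ) := by
  rw [eLpNorm_eq_lintegral_rpow_enorm_toReal (pExp_ne_zero k) (pExp_ne_top k),
    ← ENNReal.rpow_natCast, ← ENNReal.rpow_mul, toReal_pExp]
  congr 1
  push_cast
  field_simp

section Correlation

variable {G : Type*} [MeasurableSpace G] {μ : Measure G} [AddGroup G] [MeasurableAdd₂ G]
  [SFinite μ] [μ.IsAddLeftInvariant] {f g : G → ℝ}

theorem aemeasurable_eLpNorm_mul_comp_add_pow (k : ℕ) (hf : AEStronglyMeasurable f μ)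
    (hg : AEStronglyMeasurable g μ) :
    AEMeasurable (fun h => eLpNorm (fun x => f x * g (x + h)) (pExp k) μ ^ 2 ^ k) μ := by
  simp only [eLpNorm_pExp_pow, enorm_mul, ENNReal.mul_rpow_of_nonneg _ _ ENNReal.toReal_nonneg]
  exact (aemeasurable_mul_comp_add (hf.enorm.pow_const _)
    (hg.enorm.pow_const _)).lintegral_prod_right.pow_const _

theorem lintegral_eLpNorm_mul_comp_add_pow_le [μ.IsAddRightInvariant] (k : ℕ)
    (hf : AEStronglyMeasurable f μ) (hg : AEStronglyMeasurable g μ) :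
    ∫⁻ h, eLpNorm (fun x => f x * g (x + h)) (pExp k) μ ^ 2 ^ k ∂μ ≤
      (eLpNorm f (pExp (k + 1)) μ * eLpNorm g (pExp (k + 1)) μ) ^ 2 ^ k := by
  set s : ℝ := 2 * (k + 1) / (k + 2) with hs
  have hs₁ : 1 ≤ s := (one_le_div (by positivity)).2 (by linarith [k.cast_nonneg (α := ℝ)])
  have hexp : (pExp k).toReal * s = (pExp (k + 1)).toReal := by
    rw [toReal_pExp, toReal_pExp, hs]
    push_cast
    field_simp
    ring
  have hpow (u : G → ℝ) : (∫⁻ x, ‖u x‖ₑ ^ (pExp (k + 1)).toReal ∂μ) ^ ((k + 1 : ℝ) / s) =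
      eLpNorm u (pExp (k + 1)) μ ^ 2 ^ k := by
    rw [eLpNorm_eq_lintegral_rpow_enorm_toReal (pExp_ne_zero _) (pExp_ne_top _),
      ← ENNReal.rpow_natCast, ← ENNReal.rpow_mul, toReal_pExp, hs]
    congr 1
    push_cast
    field_simp
    ring
  have young := lintegral_lintegral_mul_comp_add_rpow_le hs₁ hs₁ (r := k + 1) (by positivity)
    (by rw [hs]; field_simp; ring) (hf.enorm.pow_const (pExp k).toReal)
    (hg.enorm.pow_const (pExp k).toReal)
  simp only [← ENNReal.rpow_mul, hexp, hpow] at young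
  simpa only [eLpNorm_pExp_pow k, enorm_mul, mul_pow,
    ENNReal.mul_rpow_of_nonneg _ _ ENNReal.toReal_nonneg] using young

end Correlation

section Cube

variable {d k : ℕ}

theorem prod_vertex_succ {M : Type*} [CommMonoid M] (φ : (Fin (k + 1) → Bool) → M) :
    ∏ α, φ α = ∏ α : Fin k → Bool, φ (Fin.cons false α) * φ (Fin.cons true α) := by
  rw [← (Fin.consEquiv fun _ : Fin (k + 1) => Bool).prod_comp, Fintype.prod_prod_type,
    Fintype.prod_bool, mul_comm, Finset.prod_mul_distrib]
  rfl

theorem lintegral_prod_vertex_rpow_le {β : Type*} [MeasurableSpace β] {μ : Measure β}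
    {φ : (Fin k → Bool) → β → ℝ≥0∞} (hφ : ∀ α, AEMeasurable (φ α) μ) :
    ∫⁻ x, ∏ α, φ α x ^ ((2 : ℝ) ^ k)⁻¹ ∂μ ≤ ∏ α, (∫⁻ x, φ α x ∂μ) ^ ((2 : ℝ) ^ k)⁻¹ :=
  ENNReal.lintegral_prod_norm_pow_le _ (fun α _ => hφ α) (by simp) fun _ _ => by positivity

/-- The product of a family of functions over the vertices `x + α · h` of the cube with
differences `h = z.1` and base point `x = z.2`. -/
def cubeProd (F : (Fin k → Bool) → ℝ^d → ℝ) (z : (Fin k → ℝ^d) × ℝ^d) : ℝ :=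
  ∏ α, F α (z.2 + cubeDot α z.1)

/-- The product of the two faces of a family in the first direction, the upper one shifted
by `h`; it reduces a `(k + 1)`-dimensional cube to a `k`-dimensional one. -/
def pairFamily (h : ℝ^d) (F : (Fin (k + 1) → Bool) → ℝ^d → ℝ) (α : Fin k → Bool) (x : ℝ^d) : ℝ :=
  F (Fin.cons false α) x * F (Fin.cons true α) (x + h)

theorem cubeDot_cons (b : Bool) (α : Fin k → Bool) (h₀ : ℝ^d) (h : Fin k → ℝ^d) :
    cubeDot (Fin.cons b α : Fin (k + 1) → Bool) (Fin.cons h₀ h : Fin (k + 1) → ℝ^d) =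
      (if b then h₀ else 0) + cubeDot α h := by
  simp [cubeDot, Fin.sum_univ_succ]

theorem cubeProd_cons (F : (Fin (k + 1) → Bool) → ℝ^d → ℝ) (h₀ : ℝ^d) (h : Fin k → ℝ^d) (x : ℝ^d) :
    cubeProd F (Fin.cons h₀ h, x) = cubeProd (pairFamily h₀ F) (h, x) := by
  simp only [cubeProd, pairFamily, prod_vertex_succ, cubeDot_cons, if_true, Bool.false_eq_true,
    if_false, zero_add, add_assoc, add_comm h₀]

theorem measurable_cubeDot (α : Fin k → Bool) : Measurable (cubeDot (d := d) α) := by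
  unfold cubeDot
  refine Finset.measurable_sum _ fun i _ => ?_
  split_ifs <;> fun_prop

theorem quasiMeasurePreserving_vertex (α : Fin k → Bool) :
    Measure.QuasiMeasurePreserving fun z : (Fin k → ℝ^d) × ℝ^d => z.2 + cubeDot α z.1 :=
  QuasiMeasurePreserving.prod_of_right
    (measurable_snd.add ((measurable_cubeDot α).comp measurable_fst))
    (.of_forall fun h => (measurePreserving_add_right volume (cubeDot α h)).quasiMeasurePreserving)

theorem aestronglyMeasurable_cubeProd {F : (Fin k → Bool) → ℝ^d → ℝ}
    (hF : ∀ α, AEStronglyMeasurable (F α)) : AEStronglyMeasurable (cubeProd F) :=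
  Finset.aestronglyMeasurable_fun_prod _ fun α _ =>
    (hF α).comp_quasiMeasurePreserving (quasiMeasurePreserving_vertex α)

theorem aestronglyMeasurable_pairFamily {F : (Fin (k + 1) → Bool) → ℝ^d → ℝ}
    (hF : ∀ α, AEStronglyMeasurable (F α)) (h : ℝ^d) (α : Fin k → Bool) :
    AEStronglyMeasurable (pairFamily h F α) :=
  (hF _).mul ((hF _).comp_measurePreserving (measurePreserving_add_right volume h))

variable (d k) in
/-- Splits off the first difference of a `(k + 1)`-dimensional cube. -/
def cubeConsEquiv :
    ℝ^d × (Fin k → ℝ^d) × ℝ^d ≃ᵐ (Fin (k + 1) → ℝ^d) × ℝ^d :=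
  MeasurableEquiv.prodAssoc.symm.trans
    ((MeasurableEquiv.piFinSuccAbove (fun _ => ℝ^d) 0).symm.prodCongr (MeasurableEquiv.refl _))

theorem cubeConsEquiv_apply (h₀ : ℝ^d) (h : Fin k → ℝ^d) (x : ℝ^d) :
    cubeConsEquiv d k (h₀, h, x) = (Fin.cons h₀ h, x) := by
  simp [cubeConsEquiv, MeasurableEquiv.prodAssoc, MeasurableEquiv.prodCongr,
    MeasurableEquiv.piFinSuccAbove, Fin.insertNthEquiv]

theorem cubeProd_cubeConsEquiv (F : (Fin (k + 1) → Bool) → ℝ^d → ℝ)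
    (w : ℝ^d × (Fin k → ℝ^d) × ℝ^d) :
    cubeProd F (cubeConsEquiv d k w) = cubeProd (pairFamily w.1 F) w.2 := by
  rw [← Prod.mk.eta (p := w), ← Prod.mk.eta (p := w.2), cubeConsEquiv_apply, cubeProd_cons]

variable (d k) in
theorem measurePreserving_cubeConsEquiv : MeasurePreserving (cubeConsEquiv d k) :=
  ((volume_preserving_piFinSuccAbove (fun _ : Fin (k + 1) => ℝ^d) 0).symm.prod
    (MeasurePreserving.id volume)).comp volume_preserving_prodAssoc.symm

theorem lintegral_enorm_cubeProd_succ {F : (Fin (k + 1) → Bool) → ℝ^d → ℝ}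
    (hF : ∀ α, AEStronglyMeasurable (F α)) :
    ∫⁻ z, ‖cubeProd F z‖ₑ = ∫⁻ h, ∫⁻ z, ‖cubeProd (pairFamily h F) z‖ₑ := by
  have hmeas := ((aestronglyMeasurable_cubeProd hF).comp_measurePreserving
    (measurePreserving_cubeConsEquiv d k)).enorm
  rw [← (measurePreserving_cubeConsEquiv d k).lintegral_comp_emb
    (cubeConsEquiv d k).measurableEmbedding, Measure.volume_eq_prod, lintegral_prod]
  · simp only [cubeProd_cubeConsEquiv]
  · exact hmeas

theorem lintegral_enorm_cubeProd_zero {F : (Fin 0 → Bool) → ℝ^d → ℝ}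
    (hF : ∀ α, AEStronglyMeasurable (F α)) :
    ∫⁻ z, ‖cubeProd F z‖ₑ = ∏ α, eLpNorm (F α) (pExp 0) := by
  have : IsProbabilityMeasure (volume : Measure (Fin 0 → ℝ^d)) := by
    rw [Measure.volume_pi_eq_dirac]
    infer_instance
  have hcomp : cubeProd F = F default ∘ Prod.snd := by
    funext z
    rw [cubeProd, Fintype.prod_subsingleton _ default]
    simp [cubeDot]
  rw [← eLpNorm_one_eq_lintegral_enorm, hcomp, Measure.volume_eq_prod,
    eLpNorm_comp_measurePreserving (hF _) measurePreserving_snd]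
  rw [Fintype.prod_subsingleton _ default]
  simp [pExp]

theorem lintegral_enorm_cubeProd_le {F : (Fin k → Bool) → ℝ^d → ℝ}
    (hF : ∀ α, AEStronglyMeasurable (F α)) :
    ∫⁻ z, ‖cubeProd F z‖ₑ ≤ ∏ α, eLpNorm (F α) (pExp k) := by
  induction k with
  | zero => exact (lintegral_enorm_cubeProd_zero hF).le
  | succ k ih =>
    have hpair (h : ℝ^d) : ∫⁻ z, ‖cubeProd (pairFamily h F) z‖ₑ ≤
        ∏ α : Fin k → Bool, eLpNorm (pairFamily h F α) (pExp k) :=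
      ih (aestronglyMeasurable_pairFamily hF h)
    have hroot (a : ℝ≥0∞) : (a ^ 2 ^ k) ^ ((2 : ℝ) ^ k)⁻¹ = a := by
      rw [← ENNReal.rpow_natCast, Nat.cast_pow, Nat.cast_ofNat,
        ENNReal.rpow_rpow_inv (by positivity)]
    have hmeas (α : Fin k → Bool) :
        AEMeasurable fun h => eLpNorm (pairFamily h F α) (pExp k) ^ 2 ^ k :=
      aemeasurable_eLpNorm_mul_comp_add_pow k (hF _) (hF _)
    calc ∫⁻ z, ‖cubeProd F z‖ₑ
        = ∫⁻ h, ∫⁻ z, ‖cubeProd (pairFamily h F) z‖ₑ := lintegral_enorm_cubeProd_succ hF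
      _ ≤ ∫⁻ h, ∏ α, eLpNorm (pairFamily h F α) (pExp k) volume :=
          lintegral_mono hpair
      _ = ∫⁻ h, ∏ α, (eLpNorm (pairFamily h F α) (pExp k) volume ^ 2 ^ k) ^ ((2 : ℝ) ^ k)⁻¹ := by
          simp only [hroot]
      _ ≤ ∏ α, (∫⁻ h, eLpNorm (pairFamily h F α) (pExp k) volume ^ 2 ^ k) ^ ((2 : ℝ) ^ k)⁻¹ :=
          lintegral_prod_vertex_rpow_le hmeas
      _ ≤ ∏ α : Fin k → Bool, eLpNorm (F (Fin.cons false α)) (pExp (k + 1)) volume *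
            eLpNorm (F (Fin.cons true α)) (pExp (k + 1)) volume := by
          refine Finset.prod_le_prod' fun α _ => ?_
          exact (ENNReal.rpow_le_rpow (lintegral_eLpNorm_mul_comp_add_pow_le k (hF _) (hF _))
            (by positivity)).trans_eq (hroot _)
      _ = ∏ α, eLpNorm (F α) (pExp (k + 1)) volume :=
          (prod_vertex_succ fun α => eLpNorm (F α) (pExp (k + 1)) volume).symm

end Cube

section GowersForm

variable {d k : ℕ}

theorem integrable_cubeProd {F : (Fin k → Bool) → ℝ^d → ℝ}
    (hF : ∀ α, MemLp (F α) (pExp k)) : Integrable (cubeProd F) :=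
  ⟨aestronglyMeasurable_cubeProd fun α => (hF α).1,
    (lintegral_enorm_cubeProd_le fun α => (hF α).1).trans_lt
      (ENNReal.prod_lt_top fun α _ => (hF α).2)⟩

/-- The multilinear Gowers form of a family of functions indexed by the vertices of a cube. -/
def cubeForm (F : (Fin k → Bool) → ℝ^d → ℝ) : ℝ :=
  ∫ z, cubeProd F z

/-- The Gowers form with all entries equal to `f`, which is the `2 ^ k`-th power of the
Gowers norm of `f`. -/
def cubeEnergy (k : ℕ) (f : ℝ^d → ℝ) : ℝ :=
  cubeForm fun _ : Fin k → Bool => f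

theorem integrable_cubeProd_pairFamily {F : (Fin (k + 1) → Bool) → ℝ^d → ℝ}
    (hF : ∀ α, MemLp (F α) (pExp (k + 1))) :
    Integrable fun w : ℝ^d × (Fin k → ℝ^d) × ℝ^d => cubeProd (pairFamily w.1 F) w.2 := by
  simpa only [Function.comp_def, cubeProd_cubeConsEquiv] using
    (measurePreserving_cubeConsEquiv d k).integrable_comp_of_integrable (integrable_cubeProd hF)

theorem cubeForm_eq_integral_cubeProd_pairFamily (F : (Fin (k + 1) → Bool) → ℝ^d → ℝ) :
    cubeForm F = ∫ w : ℝ^d × (Fin k → ℝ^d) × ℝ^d, cubeProd (pairFamily w.1 F) w.2 := by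
  rw [cubeForm, ← (measurePreserving_cubeConsEquiv d k).integral_comp']
  simp only [cubeProd_cubeConsEquiv]

theorem cubeForm_succ {F : (Fin (k + 1) → Bool) → ℝ^d → ℝ}
    (hF : ∀ α, MemLp (F α) (pExp (k + 1))) :
    cubeForm F = ∫ h, cubeForm (pairFamily h F) := by
  rw [cubeForm_eq_integral_cubeProd_pairFamily, Measure.volume_eq_prod,
    integral_prod _ (integrable_cubeProd_pairFamily hF)]
  rfl

theorem integrable_cubeForm_pairFamily {F : (Fin (k + 1) → Bool) → ℝ^d → ℝ}
    (hF : ∀ α, MemLp (F α) (pExp (k + 1))) : Integrable fun h => cubeForm (pairFamily h F) :=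
  (integrable_cubeProd_pairFamily hF).integral_prod_left

theorem ae_memLp_mul_comp_add {f g : ℝ^d → ℝ} (hf : MemLp f (pExp (k + 1)))
    (hg : MemLp g (pExp (k + 1))) : ∀ᵐ h : ℝ^d, MemLp (fun x => f x * g (x + h)) (pExp k) := by
  have hfin : ∫⁻ h : ℝ^d, eLpNorm (fun x => f x * g (x + h)) (pExp k) volume ^ 2 ^ k ≠ ∞ :=
    ((lintegral_eLpNorm_mul_comp_add_pow_le k hf.1 hg.1).trans_lt
      (ENNReal.pow_lt_top (ENNReal.mul_lt_top hf.2 hg.2))).ne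
  filter_upwards [ae_lt_top' (aemeasurable_eLpNorm_mul_comp_add_pow k hf.1 hg.1) hfin]
    with h hh
  exact ⟨hf.1.mul (hg.1.comp_measurePreserving (measurePreserving_add_right volume h)),
    (ENNReal.pow_lt_top_iff.1 hh).resolve_right (by positivity)⟩

/-- The family on a `(k + 1)`-dimensional cube with entries `f` on the lower face and `g` on the
upper face in the first direction. -/
def faceFamily (f g : ℝ^d → ℝ) (α : Fin (k + 1) → Bool) : ℝ^d → ℝ :=
  bif α 0 then g else f

/-- The integral of `∏ f(x + α · h)` over the base point `x` of the cube. -/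
def cubeCorrelation (f : ℝ^d → ℝ) (h : Fin k → ℝ^d) : ℝ :=
  ∫ x, cubeProd (fun _ => f) (h, x)

theorem faceFamily_self (f : ℝ^d → ℝ) : faceFamily (k := k) f f = fun _ => f := by
  funext α
  exact Bool.cond_self _ _

theorem memLp_faceFamily {f g : ℝ^d → ℝ} {p : ℝ≥0∞} (hf : MemLp f p) (hg : MemLp g p)
    (α : Fin (k + 1) → Bool) : MemLp (faceFamily f g α) p := by
  unfold faceFamily
  cases α 0 <;> assumption

theorem pairFamily_faceFamily (f g : ℝ^d → ℝ) (h : ℝ^d) :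
    pairFamily h (faceFamily (k := k) f g) = fun _ x => f x * g (x + h) :=
  rfl

theorem cubeProd_pairFamily_faceFamily (f g : ℝ^d → ℝ) (h₀ : ℝ^d) (h : Fin k → ℝ^d) (x : ℝ^d) :
    cubeProd (pairFamily h₀ (faceFamily f g)) (h, x) =
      cubeProd (fun _ => f) (h, x) * cubeProd (fun _ => g) (h, x + h₀) := by
  simp only [pairFamily_faceFamily, cubeProd, Finset.prod_mul_distrib, add_right_comm x]

variable (d k) in
/-- Moves the first difference of a cube behind the base point. -/
def faceEquiv : (Fin k → ℝ^d) × ℝ^d × ℝ^d ≃ᵐ ℝ^d × (Fin k → ℝ^d) × ℝ^d :=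
  MeasurableEquiv.prodAssoc.symm.trans MeasurableEquiv.prodComm

variable (d k) in
theorem measurePreserving_faceEquiv : MeasurePreserving (faceEquiv d k) :=
  Measure.measurePreserving_swap.comp volume_preserving_prodAssoc.symm

theorem cubeProd_faceEquiv (f g : ℝ^d → ℝ) (w : (Fin k → ℝ^d) × ℝ^d × ℝ^d) :
    cubeProd (pairFamily (faceEquiv d k w).1 (faceFamily f g)) (faceEquiv d k w).2 =
      cubeProd (fun _ => f) (w.1, w.2.1) * cubeProd (fun _ => g) (w.1, w.2.1 + w.2.2) :=
  cubeProd_pairFamily_faceFamily f g _ _ _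

section Face

variable {f g : ℝ^d → ℝ} (hf : MemLp f (pExp (k + 1))) (hg : MemLp g (pExp (k + 1)))

include hf hg

theorem integrable_cubeProd_mul_cubeProd :
    Integrable fun w : (Fin k → ℝ^d) × ℝ^d × ℝ^d =>
      cubeProd (fun _ => f) (w.1, w.2.1) * cubeProd (fun _ => g) (w.1, w.2.1 + w.2.2) := by
  simpa only [Function.comp_def, cubeProd_faceEquiv] using
    (measurePreserving_faceEquiv d k).integrable_comp_of_integrable
      (integrable_cubeProd_pairFamily (memLp_faceFamily hf hg))

theorem ae_integral_cubeProd_mul_cubeProd :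
    ∀ᵐ h : Fin k → ℝ^d, ∫ y : ℝ^d × ℝ^d,
      cubeProd (fun _ => f) (h, y.1) * cubeProd (fun _ => g) (h, y.1 + y.2) =
        cubeCorrelation f h * cubeCorrelation g h := by
  filter_upwards [(integrable_cubeProd_mul_cubeProd hf hg).prod_right_ae] with h hh
  rw [Measure.volume_eq_prod, integral_prod _ hh]
  simp only [integral_const_mul, integral_mul_const, cubeCorrelation,
    integral_add_left_eq_self fun y => cubeProd (fun _ => g) (h, y)]

theorem integrable_cubeCorrelation_mul :
    Integrable fun h : Fin k → ℝ^d => cubeCorrelation f h * cubeCorrelation g h :=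
  (integrable_cubeProd_mul_cubeProd hf hg).integral_prod_left.congr
    (ae_integral_cubeProd_mul_cubeProd hf hg)

theorem cubeForm_faceFamily :
    cubeForm (faceFamily (k := k) f g) =
      ∫ h : Fin k → ℝ^d, cubeCorrelation f h * cubeCorrelation g h := by
  rw [cubeForm_eq_integral_cubeProd_pairFamily,
    ← (measurePreserving_faceEquiv d k).integral_comp']
  simp only [cubeProd_faceEquiv]
  rw [Measure.volume_eq_prod, integral_prod _ (integrable_cubeProd_mul_cubeProd hf hg)]
  exact integral_congr_ae (ae_integral_cubeProd_mul_cubeProd hf hg)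

omit hg

theorem cubeEnergy_succ_eq_integral_cubeCorrelation_sq :
    cubeEnergy (k + 1) f = ∫ h : Fin k → ℝ^d, cubeCorrelation f h ^ 2 := by
  simp only [cubeEnergy, ← faceFamily_self, cubeForm_faceFamily hf hf, sq]

theorem cubeEnergy_succ_nonneg : 0 ≤ cubeEnergy (k + 1) f := by
  rw [cubeEnergy_succ_eq_integral_cubeCorrelation_sq hf]
  exact integral_nonneg fun h => sq_nonneg _

theorem lintegral_enorm_cubeCorrelation_sq :
    ∫⁻ h : Fin k → ℝ^d, ‖cubeCorrelation f h‖ₑ ^ (2 : ℝ) = ‖cubeEnergy (k + 1) f‖ₑ := by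
  have hint : Integrable fun h : Fin k → ℝ^d => cubeCorrelation f h ^ 2 := by
    simpa only [sq] using integrable_cubeCorrelation_mul hf hf
  rw [Real.enorm_of_nonneg (cubeEnergy_succ_nonneg hf),
    cubeEnergy_succ_eq_integral_cubeCorrelation_sq hf,
    ofReal_integral_eq_lintegral_ofReal hint (.of_forall fun h => sq_nonneg _)]
  simp only [← Real.enorm_of_nonneg (sq_nonneg _), enorm_pow, ENNReal.rpow_two]

theorem aestronglyMeasurable_cubeCorrelation :
    AEStronglyMeasurable (cubeCorrelation (k := k) f) :=
  (aestronglyMeasurable_cubeProd fun _ => hf.1).integral_prod_right'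

include hg

theorem enorm_cubeForm_faceFamily_le :
    ‖cubeForm (faceFamily (k := k) f g)‖ₑ ≤
      (‖cubeEnergy (k + 1) f‖ₑ * ‖cubeEnergy (k + 1) g‖ₑ) ^ (2 : ℝ)⁻¹ := by
  rw [cubeForm_faceFamily hf hg, ENNReal.mul_rpow_of_nonneg _ _ (by positivity),
    ← lintegral_enorm_cubeCorrelation_sq hf, ← lintegral_enorm_cubeCorrelation_sq hg,
    ← one_div]
  refine (enorm_integral_le_lintegral_enorm _).trans ?_
  simp only [enorm_mul]
  exact ENNReal.lintegral_mul_le_Lp_mul_Lq volume Real.HolderConjugate.two_two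
    (aestronglyMeasurable_cubeCorrelation hf).enorm
    (aestronglyMeasurable_cubeCorrelation hg).enorm

end Face

theorem ae_cubeEnergy_mul_comp_add_nonneg {f g : ℝ^d → ℝ} (hf : MemLp f (pExp (k + 2)))
    (hg : MemLp g (pExp (k + 2))) :
    ∀ᵐ h : ℝ^d, 0 ≤ cubeEnergy (k + 1) fun x => f x * g (x + h) :=
  (ae_memLp_mul_comp_add hf hg).mono fun _ => cubeEnergy_succ_nonneg

theorem lintegral_enorm_cubeEnergy_mul_comp_add_le {f g : ℝ^d → ℝ}
    (hf : MemLp f (pExp (k + 2))) (hg : MemLp g (pExp (k + 2))) :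
    ∫⁻ h : ℝ^d, ‖cubeEnergy (k + 1) fun x => f x * g (x + h)‖ₑ ≤
      (‖cubeEnergy (k + 2) f‖ₑ * ‖cubeEnergy (k + 2) g‖ₑ) ^ (2 : ℝ)⁻¹ := by
  have hF := memLp_faceFamily (k := k + 1) hf hg
  have hint : Integrable fun h : ℝ^d => cubeEnergy (k + 1) fun x => f x * g (x + h) :=
    integrable_cubeForm_pairFamily hF
  have hnonneg := ae_cubeEnergy_mul_comp_add_nonneg hf hg
  calc ∫⁻ h : ℝ^d, ‖cubeEnergy (k + 1) fun x => f x * g (x + h)‖ₑ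
      = ∫⁻ h : ℝ^d, ENNReal.ofReal (cubeEnergy (k + 1) fun x => f x * g (x + h)) :=
        lintegral_congr_ae (hnonneg.mono fun h => Real.enorm_of_nonneg)
    _ = ‖∫ h : ℝ^d, cubeEnergy (k + 1) fun x => f x * g (x + h)‖ₑ := by
        rw [Real.enorm_of_nonneg (integral_nonneg_of_ae hnonneg),
          ofReal_integral_eq_lintegral_ofReal hint hnonneg]
    _ = ‖cubeForm (faceFamily (k := k + 1) f g)‖ₑ := by rw [cubeForm_succ hF]; rfl
    _ ≤ _ := enorm_cubeForm_faceFamily_le hf hg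

theorem enorm_cubeForm_one_le {F : (Fin 1 → Bool) → ℝ^d → ℝ}
    (hF : ∀ α, MemLp (F α) (pExp 1)) :
    ‖cubeForm F‖ₑ ≤ ∏ α, ‖cubeEnergy 1 (F α)‖ₑ ^ ((2 : ℝ) ^ 1)⁻¹ := by
  have hface : F = faceFamily (k := 0) (F fun _ => false) (F fun _ => true) := by
    funext α
    have hα : α = fun _ => α 0 := funext fun i => congrArg α (Subsingleton.elim i 0)
    rw [hα]
    cases α 0 <;> rfl
  rw [← (Equiv.funUnique (Fin 1) Bool).symm.prod_comp, Fintype.prod_bool, mul_comm,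
    ← ENNReal.mul_rpow_of_nonneg _ _ (by positivity), pow_one, hface]
  exact enorm_cubeForm_faceFamily_le (hF _) (hF _)

theorem enorm_cubeForm_le {F : (Fin (k + 1) → Bool) → ℝ^d → ℝ}
    (hF : ∀ α, MemLp (F α) (pExp (k + 1))) :
    ‖cubeForm F‖ₑ ≤ ∏ α, ‖cubeEnergy (k + 1) (F α)‖ₑ ^ ((2 : ℝ) ^ (k + 1))⁻¹ := by
  induction k with
  | zero => exact enorm_cubeForm_one_le hF
  | succ k ih =>
    have hexp : ((2 : ℝ) ^ (k + 2))⁻¹ = (2 : ℝ)⁻¹ * ((2 : ℝ) ^ (k + 1))⁻¹ := by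
      rw [pow_succ', mul_inv]
    have hpair : ∀ᵐ h : ℝ^d, ∀ α, MemLp (pairFamily h F α) (pExp (k + 1)) :=
      ae_all_iff.2 fun α => ae_memLp_mul_comp_add (hF _) (hF _)
    have hmeas (α : Fin (k + 1) → Bool) :
        AEMeasurable fun h => ‖cubeEnergy (k + 1) (pairFamily h F α)‖ₑ :=
      (integrable_cubeForm_pairFamily
        (memLp_faceFamily (hF (Fin.cons false α)) (hF (Fin.cons true α)))).1.enorm
    calc ‖cubeForm F‖ₑ
        ≤ ∫⁻ h, ‖cubeForm (pairFamily h F)‖ₑ := by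
          rw [cubeForm_succ hF]
          exact enorm_integral_le_lintegral_enorm _
      _ ≤ ∫⁻ h, ∏ α, ‖cubeEnergy (k + 1) (pairFamily h F α)‖ₑ ^ ((2 : ℝ) ^ (k + 1))⁻¹ :=
          lintegral_mono_ae (hpair.mono fun h hh => ih hh)
      _ ≤ ∏ α, (∫⁻ h, ‖cubeEnergy (k + 1) (pairFamily h F α)‖ₑ) ^ ((2 : ℝ) ^ (k + 1))⁻¹ :=
          lintegral_prod_vertex_rpow_le hmeas
      _ ≤ ∏ α : Fin (k + 1) → Bool, ‖cubeEnergy (k + 2) (F (Fin.cons false α))‖ₑ ^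
              ((2 : ℝ) ^ (k + 2))⁻¹ *
            ‖cubeEnergy (k + 2) (F (Fin.cons true α))‖ₑ ^ ((2 : ℝ) ^ (k + 2))⁻¹ := by
          refine Finset.prod_le_prod' fun α _ => ?_
          rw [← ENNReal.mul_rpow_of_nonneg _ _ (by positivity), hexp, ENNReal.rpow_mul]
          gcongr
          exact lintegral_enorm_cubeEnergy_mul_comp_add_le (hF _) (hF _)
      _ = ∏ α, ‖cubeEnergy (k + 2) (F α)‖ₑ ^ ((2 : ℝ) ^ (k + 2))⁻¹ :=
          (prod_vertex_succ fun α => ‖cubeEnergy (k + 2) (F α)‖ₑ ^ ((2 : ℝ) ^ (k + 2))⁻¹).symm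

end GowersForm

section GowersNorm

variable {d k : ℕ}

theorem gowersNorm_nonneg (k : ℕ) (f : ℝ^d → ℝ) : 0 ≤ gowersNorm k f := by
  match k with
  | 0 => exact le_rfl
  | 1 => exact abs_nonneg _
  | k + 2 =>
    exact Real.rpow_nonneg
      (integral_nonneg fun h => pow_nonneg (gowersNorm_nonneg (k + 1) _) _) _

theorem cubeEnergy_one {f : ℝ^d → ℝ} (hf : MemLp f (pExp 1)) :
    cubeEnergy 1 f = (∫ x, f x) ^ 2 := by
  have hcorr (h : Fin 0 → ℝ^d) : cubeCorrelation f h = ∫ x, f x := by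
    simp [cubeCorrelation, cubeProd, cubeDot]
  rw [cubeEnergy_succ_eq_integral_cubeCorrelation_sq hf]
  simp only [hcorr]
  rw [Measure.volume_pi_eq_dirac, integral_dirac]

theorem cubeEnergy_succ {f : ℝ^d → ℝ} (hf : MemLp f (pExp (k + 1))) :
    cubeEnergy (k + 1) f = ∫ h, cubeEnergy k fun x => f x * f (x + h) :=
  cubeForm_succ fun _ => hf

theorem gowersNorm_pow_eq_cubeEnergy (hk : k ≠ 0) {f : ℝ^d → ℝ} (hf : MemLp f (pExp k)) :
    gowersNorm k f ^ 2 ^ k = cubeEnergy k f := by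
  induction k, Nat.one_le_iff_ne_zero.2 hk using Nat.le_induction generalizing f with
  | base => simp only [gowersNorm, cubeEnergy_one hf, pow_one, sq_abs]
  | succ k hk₁ ih =>
    obtain ⟨k, rfl⟩ := Nat.exists_eq_add_of_le' hk₁
    have hpow : ∀ᵐ h : ℝ^d, gowersNorm (k + 1) (fun x => f (x + h) * f x) ^ 2 ^ (k + 1) =
        cubeEnergy (k + 1) fun x => f x * f (x + h) := by
      filter_upwards [ae_memLp_mul_comp_add hf hf] with h hh
      simpa only [mul_comm] using ih k.succ_ne_zero hh
    rw [gowersNorm, integral_congr_ae hpow, ← cubeEnergy_succ hf, one_div]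
    exact_mod_cast Real.rpow_inv_natCast_pow (cubeEnergy_succ_nonneg hf) (by positivity)

theorem enorm_cubeEnergy_rpow_inv (hk : k ≠ 0) {f : ℝ^d → ℝ} (hf : MemLp f (pExp k)) :
    ‖cubeEnergy k f‖ₑ ^ ((2 : ℝ) ^ k)⁻¹ = ENNReal.ofReal (gowersNorm k f) := by
  rw [← gowersNorm_pow_eq_cubeEnergy hk hf, enorm_pow, ← ENNReal.rpow_natCast,
    ← ENNReal.rpow_mul]
  simp [Real.enorm_of_nonneg (gowersNorm_nonneg k f)]

theorem abs_cubeForm_le (hk : k ≠ 0) {F : (Fin k → Bool) → ℝ^d → ℝ}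
    (hF : ∀ α, MemLp (F α) (pExp k)) : |cubeForm F| ≤ ∏ α, gowersNorm k (F α) := by
  obtain ⟨k, rfl⟩ := Nat.exists_eq_succ_of_ne_zero hk
  rw [← ENNReal.ofReal_le_ofReal_iff (Finset.prod_nonneg fun α _ => gowersNorm_nonneg _ _),
    ← Real.enorm_eq_ofReal_abs, ENNReal.ofReal_prod_of_nonneg fun α _ => gowersNorm_nonneg _ _]
  simpa only [enorm_cubeEnergy_rpow_inv hk (hF _)] using enorm_cubeForm_le hF

theorem gowersNorm_const_mul (hk : k ≠ 0) {f : ℝ^d → ℝ} (hf : MemLp f (pExp k)) (c : ℝ) :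
    gowersNorm k (fun x => c * f x) = |c| * gowersNorm k f := by
  have hnonneg := gowersNorm_nonneg k f
  refine (pow_left_inj₀ (gowersNorm_nonneg _ _) (by positivity)
    (pow_ne_zero k two_ne_zero)).1 ?_
  rw [mul_pow, gowersNorm_pow_eq_cubeEnergy hk hf, gowersNorm_pow_eq_cubeEnergy hk (hf.const_mul c),
    (even_two.pow_of_ne_zero hk).pow_abs]
  simp [cubeEnergy, cubeForm, cubeProd, Finset.prod_mul_distrib, integral_const_mul]

end GowersNorm

section DualFunction

variable {d k : ℕ}

theorem holderConjugate_two_pow_div (hk : 2 ≤ k) :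
    Real.HolderConjugate ((2 : ℝ) ^ k / (k + 1)) ((2 : ℝ) ^ k / ((2 : ℝ) ^ k - k - 1)) := by
  have hlt : k + 1 < 2 ^ k := by
    induction k, hk using Nat.le_induction with
    | base => norm_num
    | succ k _ ih => rw [pow_succ]; omega
  have hlt' : (k : ℝ) + 1 < 2 ^ k := by exact_mod_cast hlt
  rw [Real.holderConjugate_iff, one_lt_div (by positivity), inv_div, inv_div]
  refine ⟨hlt', ?_⟩
  field_simp
  ring

instance holderConjugate_pExp_sExp [Fact (2 ≤ k)] : (pExp k).HolderConjugate (sExp k) :=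
  (holderConjugate_two_pow_div Fact.out).ennrealOfReal

instance fact_one_le_pExp [Fact (2 ≤ k)] : Fact (1 ≤ pExp k) :=
  ⟨ENNReal.HolderConjugate.one_le (pExp k) (sExp k)⟩

theorem sExp_ne_top (k : ℕ) : sExp k ≠ ∞ :=
  ENNReal.ofReal_ne_top

/-- The family with entry `g` at the vertex `0` of the cube and `f` at all other vertices; its
Gowers form is the pairing of `g` with the dual function of `f`. -/
def pinFamily (k : ℕ) (g f : ℝ^d → ℝ) : (Fin k → Bool) → ℝ^d → ℝ :=
  Function.update (fun _ => f) (fun _ => false) g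

theorem pinFamily_self (f : ℝ^d → ℝ) : pinFamily k f f = fun _ => f :=
  Function.update_eq_self _ _

theorem aestronglyMeasurable_pinFamily {g f : ℝ^d → ℝ} (hg : AEStronglyMeasurable g)
    (hf : AEStronglyMeasurable f) (α : Fin k → Bool) :
    AEStronglyMeasurable (pinFamily k g f α) := by
  rw [pinFamily, Function.update_apply]
  split_ifs <;> assumption

theorem memLp_pinFamily {p : ℝ≥0∞} {g f : ℝ^d → ℝ} (hg : MemLp g p) (hf : MemLp f p)
    (α : Fin k → Bool) : MemLp (pinFamily k g f α) p := by
  rw [pinFamily, Function.update_apply]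
  split_ifs <;> assumption

theorem prod_pinFamily {M : Type*} [CommMonoid M] (g f : ℝ^d → ℝ)
    (φ : (Fin k → Bool) → (ℝ^d → ℝ) → M) :
    ∏ α, φ α (pinFamily k g f α) =
      φ (fun _ => false) g * ∏ α ∈ Finset.univ.erase (fun _ => false), φ α f := by
  rw [← Finset.mul_prod_erase _ _ (Finset.mem_univ fun _ : Fin k => false), pinFamily,
    Function.update_self]
  congr 1
  exact Finset.prod_congr rfl fun α hα => by
    rw [Function.update_of_ne (Finset.ne_of_mem_erase hα)]

theorem prod_pinFamily_const {M : Type*} [CommMonoid M] (g f : ℝ^d → ℝ) (φ : (ℝ^d → ℝ) → M) :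
    ∏ α, φ (pinFamily k g f α) = φ g * φ f ^ (2 ^ k - 1) := by
  simp [prod_pinFamily g f fun _ => φ, Finset.card_erase_of_mem]

theorem cubeProd_pinFamily (g f : ℝ^d → ℝ) (h : Fin k → ℝ^d) (x : ℝ^d) :
    cubeProd (pinFamily k g f) (h, x) = g x * dualIntegrand k f x h := by
  rw [cubeProd, prod_pinFamily g f fun α u => u (x + cubeDot α h)]
  simp [cubeDot, dualIntegrand]

section Measurability

variable {f : ℝ^d → ℝ} (hf : AEStronglyMeasurable f)

include hf

theorem aestronglyMeasurable_uncurry_dualIntegrand :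
    AEStronglyMeasurable (Function.uncurry (dualIntegrand k f)) := by
  have hpin (z : ℝ^d × (Fin k → ℝ^d)) :
      cubeProd (pinFamily k (fun _ => 1) f) z.swap = Function.uncurry (dualIntegrand k f) z :=
    (cubeProd_pinFamily _ _ _ _).trans (one_mul _)
  have hmeas := aestronglyMeasurable_cubeProd
    (aestronglyMeasurable_pinFamily (k := k) (aestronglyMeasurable_const (b := 1)) hf)
  exact hmeas.prod_swap.congr (.of_forall hpin)

theorem ae_aestronglyMeasurable_dualIntegrand :
    ∀ᵐ x : ℝ^d, AEStronglyMeasurable (dualIntegrand k f x) :=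
  (aestronglyMeasurable_uncurry_dualIntegrand hf).prodMk_left

theorem aestronglyMeasurable_dualFunction : AEStronglyMeasurable (dualFunction k f) :=
  (aestronglyMeasurable_uncurry_dualIntegrand hf).integral_prod_right'

theorem lintegral_enorm_mul_lintegral_enorm_dualIntegrand_le {g : ℝ^d → ℝ}
    (hg : AEStronglyMeasurable g) :
    ∫⁻ x, ‖g x‖ₑ * ∫⁻ h, ‖dualIntegrand k f x h‖ₑ ≤
      eLpNorm g (pExp k) * eLpNorm f (pExp k) ^ (2 ^ k - 1) := by
  have hpin := aestronglyMeasurable_pinFamily (k := k) hg hf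
  calc ∫⁻ x, ‖g x‖ₑ * ∫⁻ h, ‖dualIntegrand k f x h‖ₑ
      = ∫⁻ x, ∫⁻ h, ‖cubeProd (pinFamily k g f) (h, x)‖ₑ := by
        simp only [cubeProd_pinFamily, enorm_mul, lintegral_const_mul' _ _ enorm_ne_top]
    _ = ∫⁻ z, ‖cubeProd (pinFamily k g f) z‖ₑ :=
        (lintegral_prod_symm _ (aestronglyMeasurable_cubeProd hpin).enorm).symm
    _ ≤ ∏ α, eLpNorm (pinFamily k g f α) (pExp k) volume := lintegral_enorm_cubeProd_le hpin
    _ = eLpNorm g (pExp k) volume * eLpNorm f (pExp k) volume ^ (2 ^ k - 1) :=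
        prod_pinFamily_const g f fun u => eLpNorm u (pExp k) volume

theorem eLpNorm_lintegral_enorm_dualIntegrand_le [Fact (2 ≤ k)] :
    eLpNorm (fun x => ∫⁻ h, ‖dualIntegrand k f x h‖ₑ) (sExp k) ≤
      eLpNorm f (pExp k) ^ (2 ^ k - 1) := by
  refine eLpNorm_le_of_forall_lintegral_mul_le (pExp_ne_top k) (sExp_ne_top k) fun u _ => ?_
  have hu : AEStronglyMeasurable fun x : ℝ^d => (u x : ℝ) :=
    u.measurable.coe_nnreal_real.aestronglyMeasurable
  simpa only [NNReal.enorm_eq, mul_comm] using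
    lintegral_enorm_mul_lintegral_enorm_dualIntegrand_le hf hu

end Measurability

theorem ae_integrable_dualIntegrand [Fact (2 ≤ k)] {f : ℝ^d → ℝ} (hf : MemLp f (pExp k)) :
    ∀ᵐ x : ℝ^d, Integrable (dualIntegrand k f x) := by
  have hmeas : AEMeasurable fun x => ∫⁻ h, ‖dualIntegrand k f x h‖ₑ :=
    (aestronglyMeasurable_uncurry_dualIntegrand hf.1).enorm.lintegral_prod_right'
  have hs := ENNReal.HolderConjugate.ne_zero (sExp k) (pExp k)
  have hfin := lintegral_rpow_enorm_lt_top_of_eLpNorm_lt_top hs (sExp_ne_top k)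
    ((eLpNorm_lintegral_enorm_dualIntegrand_le hf.1).trans_lt (ENNReal.pow_lt_top hf.2))
  filter_upwards [ae_aestronglyMeasurable_dualIntegrand hf.1,
    ae_lt_top' (hmeas.pow_const _) hfin.ne] with x hx hx_fin
  exact ⟨hx, (ENNReal.rpow_lt_top_iff_of_pos (ENNReal.toReal_pos hs (sExp_ne_top k))).1 hx_fin⟩

theorem memLp_dualFunction [Fact (2 ≤ k)] {f : ℝ^d → ℝ} (hf : MemLp f (pExp k)) :
    MemLp (dualFunction k f) (sExp k) :=
  ⟨aestronglyMeasurable_dualFunction hf.1,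
    ((eLpNorm_mono_enorm fun _ => enorm_integral_le_lintegral_enorm _).trans
      (eLpNorm_lintegral_enorm_dualIntegrand_le hf.1)).trans_lt (ENNReal.pow_lt_top hf.2)⟩

theorem integral_mul_dualFunction {g f : ℝ^d → ℝ} (hg : MemLp g (pExp k))
    (hf : MemLp f (pExp k)) :
    ∫ x, g x * dualFunction k f x = cubeForm (pinFamily k g f) := by
  rw [cubeForm, Measure.volume_eq_prod,
    integral_prod_symm _ (integrable_cubeProd (memLp_pinFamily hg hf))]
  simp only [cubeProd_pinFamily, integral_const_mul, dualFunction]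

theorem abs_integral_mul_dualFunction_le (hk : k ≠ 0) {g f : ℝ^d → ℝ} (hg : MemLp g (pExp k))
    (hf : MemLp f (pExp k)) :
    |∫ x, g x * dualFunction k f x| ≤ gowersNorm k g * gowersNorm k f ^ (2 ^ k - 1) := by
  rw [integral_mul_dualFunction hg hf, ← prod_pinFamily_const g f (gowersNorm k)]
  exact abs_cubeForm_le hk (memLp_pinFamily hg hf)

theorem integral_mul_dualFunction_self (hk : k ≠ 0) {f : ℝ^d → ℝ} (hf : MemLp f (pExp k)) :
    ∫ x, f x * dualFunction k f x = gowersNorm k f ^ 2 ^ k := by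
  rw [integral_mul_dualFunction hf hf, pinFamily_self, gowersNorm_pow_eq_cubeEnergy hk hf,
    cubeEnergy]

theorem integral_mul_dualFunction_normalize (hk : k ≠ 0) {f : ℝ^d → ℝ} (hf : MemLp f (pExp k))
    (hf₀ : gowersNorm k f ≠ 0) :
    ∫ x, f x * dualFunction k (fun y => (gowersNorm k f)⁻¹ * f y) x = gowersNorm k f := by
  have hself := integral_mul_dualFunction_self hk (hf.const_mul (gowersNorm k f)⁻¹)
  rw [gowersNorm_const_mul hk hf, abs_of_nonneg (inv_nonneg.2 (gowersNorm_nonneg k f)),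
    inv_mul_cancel₀ hf₀, one_pow] at hself
  simp only [mul_assoc, integral_const_mul] at hself
  exact ((inv_mul_eq_one₀ hf₀).1 hself).symm

end DualFunction

section UnitBall

variable {d k : ℕ}

theorem mem_antiUniformUnitBall_iff {g : Lp ℝ (sExp k) (volume : Measure (ℝ^d))} :
    g ∈ antiUniformUnitBall d k ↔ ∀ f : ℝ^d → ℝ,
      MemLp f (pExp k) → gowersNorm k f ≤ 1 → |∫ x, f x * g x| ≤ 1 := by
  simp only [mul_comm _ (g _)]
  refine ⟨fun ⟨hbdd, hsup⟩ f hf hf₁ => (le_csSup hbdd ⟨f, hf, hf₁, rfl⟩).trans hsup, fun h => ?_⟩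
  have hle : ∀ r ∈ pairingValues k g, r ≤ 1 := by
    rintro r ⟨f, hf, hf₁, rfl⟩
    exact h f hf hf₁
  exact ⟨⟨1, hle⟩, Real.sSup_le hle zero_le_one⟩

variable [Fact (2 ≤ k)]

variable (d k) in
theorem antiUniformUnitBall_eq_iInter_preimage :
    antiUniformUnitBall d k =
      ⋂ (f : ℝ^d → ℝ) (hf : MemLp f (pExp k)) (_ : gowersNorm k f ≤ 1),
        (ContinuousLinearMap.mul ℝ ℝ).lpPairing volume (pExp k) (sExp k) (hf.toLp f) ⁻¹'
          Metric.closedBall 0 1 := by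
  ext g
  simp only [mem_antiUniformUnitBall_iff, Set.mem_iInter, Set.mem_preimage,
    mem_closedBall_zero_iff, Real.norm_eq_abs, lpPairing_mul_apply]

variable (d k) in
theorem convex_antiUniformUnitBall : Convex ℝ (antiUniformUnitBall d k) := by
  rw [antiUniformUnitBall_eq_iInter_preimage]
  exact convex_iInter fun f => convex_iInter fun hf => convex_iInter fun _ =>
    (convex_closedBall 0 1).linear_preimage (ContinuousLinearMap.toLinearMap _)

variable (d k) in
theorem isClosed_antiUniformUnitBall : IsClosed (antiUniformUnitBall d k) := by
  rw [antiUniformUnitBall_eq_iInter_preimage]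
  exact isClosed_iInter fun f => isClosed_iInter fun hf => isClosed_iInter fun _ =>
    Metric.isClosed_closedBall.preimage (ContinuousLinearMap.continuous _)

theorem ne_zero_of_fact_two_le : k ≠ 0 :=
  (two_pos.trans_le (Fact.out : 2 ≤ k)).ne'

variable (d k) in
theorem dualSet_subset_antiUniformUnitBall : dualSet d k ⊆ antiUniformUnitBall d k := by
  rintro φ ⟨f, hf, hf₁, hφ⟩
  refine mem_antiUniformUnitBall_iff.2 fun g hg hg₁ => ?_
  calc |∫ x, g x * φ x|
      = |∫ x, g x * dualFunction k f x| := by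
        rw [integral_congr_ae (hφ.mono fun x hx => congrArg (g x * ·) hx)]
    _ ≤ gowersNorm k g * gowersNorm k f ^ (2 ^ k - 1) :=
        abs_integral_mul_dualFunction_le ne_zero_of_fact_two_le hg hf
    _ ≤ 1 := mul_le_one₀ hg₁ (pow_nonneg (gowersNorm_nonneg k f) _)
        (pow_le_one₀ (gowersNorm_nonneg k f) hf₁)

theorem toLp_dualFunction_mem_dualSet {f : ℝ^d → ℝ} (hf : MemLp f (pExp k))
    (hf₁ : gowersNorm k f ≤ 1) : (memLp_dualFunction hf).toLp _ ∈ dualSet d k :=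
  ⟨f, hf, hf₁, (memLp_dualFunction hf).coeFn_toLp⟩

theorem gowersNorm_lt_of_forall_mem_dualSet {f : ℝ^d → ℝ} (hf : MemLp f (pExp k)) {u : ℝ}
    (hu : ∀ φ ∈ dualSet d k, ∫ x, f x * φ x < u) : gowersNorm k f < u := by
  have hk : k ≠ 0 := ne_zero_of_fact_two_le
  have hdual {v : ℝ^d → ℝ} (hv : MemLp v (pExp k)) (hv₁ : gowersNorm k v ≤ 1) :
      ∫ x, f x * dualFunction k v x < u := by
    rw [← integral_congr_ae ((memLp_dualFunction hv).coeFn_toLp.mono fun x hx =>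
      congrArg (f x * ·) hx)]
    exact hu _ (toLp_dualFunction_mem_dualSet hv hv₁)
  rcases eq_or_ne (gowersNorm k f) 0 with h₀ | h₀
  · have hself := hdual hf (h₀.trans_le zero_le_one)
    rwa [integral_mul_dualFunction_self hk hf, h₀, zero_pow (by positivity), ← h₀] at hself
  · have hnorm : gowersNorm k (fun x => (gowersNorm k f)⁻¹ * f x) = 1 := by
      rw [gowersNorm_const_mul hk hf, abs_of_nonneg (inv_nonneg.2 (gowersNorm_nonneg k f)),
        inv_mul_cancel₀ h₀]
    rw [← integral_mul_dualFunction_normalize hk hf h₀]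
    exact hdual (hf.const_mul _) hnorm.le

theorem abs_integral_mul_le_of_gowersNorm_le {g : Lp ℝ (sExp k) (volume : Measure (ℝ^d))}
    (hg : g ∈ antiUniformUnitBall d k) {f : ℝ^d → ℝ} (hf : MemLp f (pExp k)) {u : ℝ} (hu : 0 < u)
    (hfu : gowersNorm k f ≤ u) : |∫ x, f x * g x| ≤ u := by
  have hscaled := mem_antiUniformUnitBall_iff.1 hg _ (hf.const_mul u⁻¹) (by
    rwa [gowersNorm_const_mul ne_zero_of_fact_two_le hf, abs_of_pos (inv_pos.2 hu),
      inv_mul_le_one₀ hu])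
  simpa only [mul_assoc, integral_const_mul, abs_mul, abs_of_pos (inv_pos.2 hu),
    inv_mul_le_one₀ hu] using hscaled

variable (d k) in
theorem antiUniformUnitBall_subset_closedConvexHull :
    antiUniformUnitBall d k ⊆ closedConvexHull ℝ (dualSet d k) := by
  intro g hg
  by_contra hg_hull
  obtain ⟨Λ, u, hΛu, huΛ⟩ := geometric_hahn_banach_closed_point
    convex_closedConvexHull isClosed_closedConvexHull hg_hull
  obtain ⟨f, hf, hΛ⟩ := exists_memLp_forall_eq_integral_mul (q := pExp k) (sExp_ne_top k)
    (pExp_ne_top k) Λ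
  have hfu : gowersNorm k f < u := gowersNorm_lt_of_forall_mem_dualSet hf fun φ hφ =>
    hΛ φ ▸ hΛu φ (subset_closedConvexHull hφ)
  have hΛg : |Λ g| ≤ u := hΛ g ▸
    abs_integral_mul_le_of_gowersNorm_le hg hf ((gowersNorm_nonneg k f).trans_lt hfu) hfu.le
  exact huΛ.not_ge ((le_abs_self _).trans hΛg)

end UnitBall

end AntiUniform

end

theorem lemma3 (d k : ℕ) [Fact (2 ≤ k)] :
    (∀ f : EuclideanSpace ℝ (Fin d) → ℝ, MemLp f (AntiUniform.pExp k) volume →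
      (∀ᵐ x : EuclideanSpace ℝ (Fin d),
        Integrable (AntiUniform.dualIntegrand k f x) volume) ∧
      MemLp (AntiUniform.dualFunction k f) (AntiUniform.sExp k) volume) ∧
    AntiUniform.antiUniformUnitBall d k =
      closedConvexHull ℝ (AntiUniform.dualSet d k) :=
  ⟨fun _ hf => ⟨AntiUniform.ae_integrable_dualIntegrand hf, AntiUniform.memLp_dualFunction hf⟩,
    (AntiUniform.antiUniformUnitBall_subset_closedConvexHull d k).antisymm
      (closedConvexHull_min (AntiUniform.dualSet_subset_antiUniformUnitBall d k)
        (AntiUniform.convex_antiUniformUnitBall d k)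
        (AntiUniform.isClosed_antiUniformUnitBall d k))⟩
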